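/- Let $A$ be an abelian group, let $B$ be a subgroup of $A$, and let $l$ be a positive integer. Suppose that $A/B$ is finite and $l$-torsion, i.e. $x^l=1$ for every $x\in A/B$. Put $R=\mathbb{Z}[1/l]$ and let $M$ be a module over the group ring $R[A]$. For a subgroup $H\le A$ write $$M_H=M/\langle m-hm \mid h\in H,\ m\in M\rangle,\qquad M^H=\{m\in M \mid hm=m \text{ for every } h\in H\},$$ each with the $A$-action induced from that on $M$ (so that $A$ acts trivially on $M_A$ and $M^A$). Then for every $n\ge 0$ the natural surjection $M_B\to M_A$ and the inclusion $M^A\to M^B$ of $A$-modules induce isomorphisms $$H_n(A,M_B)\xrightarrow{\ \simeq\ }H_n(A,M_A),\qquad H^n(A,M^A)\xrightarrow{\ \simeq\ }H^n(A,M^B).$$ -/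

import Mathlib

open CategoryTheory

universe u w

noncomputable section

namespace CoinvInv

variable {k : Type u} {G : Type w} [CommRing k] [Group G]

/-- The `G`-coinvariants `M_G = M / ⟨g m - m⟩` as a `G`-module with trivial action. -/
abbrev trivialCoinvariants (M : Rep.{w} k G) : Rep.{w} k G :=
  Rep.trivial k G M.ρ.Coinvariants

/-- The `G`-invariants `M^G = {m | g m = m for all g}` as a `G`-module with trivial action. -/
abbrev trivialInvariants (M : Rep.{w} k G) : Rep.{w} k G :=
  Rep.trivial k G M.ρ.invariants

variable (M : Rep.{w} k G) (S : Subgroup G) [S.Normal]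

/-- The natural map of `G`-modules `M_S ⟶ M_G`, sending the class of `m` in `M_S` to the class
of `m` in `M_G`, for a normal subgroup `S` of `G`. Here `G` acts on `M_S` through its
action on `M`. -/
def coinvariantsToCoinvariants : M.toCoinvariants S ⟶ trivialCoinvariants M :=
  Rep.ofHom
    ⟨Representation.Coinvariants.lift (M.ρ.comp S.subtype) (Representation.Coinvariants.mk M.ρ)
        fun s => LinearMap.ext fun m => Representation.Coinvariants.mk_self_apply M.ρ (s : G) m,
      fun g => LinearMap.ext fun x =>
        Representation.Coinvariants.induction_on x fun m =>
          Representation.Coinvariants.mk_self_apply M.ρ g m⟩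

/-- The natural map of `G`-modules `M^G ⟶ M^S`, the inclusion, for a normal subgroup `S` of `G`.
Here `G` acts on `M^S` through its action on `M`. -/
def invariantsToInvariants : trivialInvariants M ⟶ M.toInvariants S :=
  Rep.ofHom
    ⟨Submodule.inclusion (p := M.ρ.invariants)
        (p' := Representation.invariants (M.ρ.comp S.subtype)) fun _ hm s => hm (s : G),
      fun g => LinearMap.ext fun m => Subtype.ext (m.2 g).symm⟩

/-- On classes, the natural map `M_S ⟶ M_G` sends `[m]` to `[m]`. -/
theorem coinvariantsToCoinvariants_mk (m : M) :
    (coinvariantsToCoinvariants M S).hom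
      (Representation.Coinvariants.mk (M.ρ.comp S.subtype) m) =
      Representation.Coinvariants.mk M.ρ m := rfl

/-- The natural map `M^G ⟶ M^S` sends `m` to `m`. -/
theorem coe_invariantsToInvariants (m : M.ρ.invariants) :
    (((invariantsToInvariants M S).hom m :
      Representation.invariants (M.ρ.comp S.subtype)) : M) = (m : M) := rfl

end CoinvInv

end

/-!
The argument is a transfer argument. Both natural maps have a transfer in the opposite direction,
given by the sum over `G ⧸ S`:
`t : M_G ⟶ M_S`, `[m] ↦ ∑ q, [q m]`, and `t : M^S ⟶ M^G`, `m ↦ ∑ q, q m`.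
Composing a natural map `π` with its transfer gives multiplication by `N = |G ⧸ S|` on `M_G` (resp.
`M^G`), and the endomorphism `∑ q, q` of the `G`-module `M_S` (resp. `M^S`); the latter is a
morphism of `G`-modules because `G` is commutative.

The action of a fixed `g : G` on a `G`-module `V` induces the identity on `Hₙ(G, V)` and
`Hⁿ(G, V)` (`groupHomology.functor_map_applyAsHom`, `groupCohomology.functor_map_applyAsHom`).
Indeed, if `P` is the bar resolution of the trivial module `k`, then the action of `g` on
`Hom(P, V)` through `V` agrees with the action through `P`, and the action of `g⁻¹` on `P` gives the
action of `g` on `V` in `(V ⊗ P)_G`. As `g` acts trivially on `k`, its action on `P` is a lift of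
the identity of `k`, hence homotopic to the identity.

So on (co)homology both composites of `π` and its transfer are multiplication by `N`. Finally `N`
divides a power of the exponent of `G ⧸ S`, hence a power of `l`, so it is invertible in `ℤ[1/l]`.
-/

/-! ### Endomorphisms of complexes that are homotopic to the identity -/

/-- An endomorphism that is conjugate, by an isomorphism of complexes, to one homotopic to the
identity induces the identity on homology. -/
theorem HomologicalComplex.homologyMap_eq_id_of_homotopy_conj {C ι : Type*} [Category* C]
    [Preadditive C] [CategoryWithHomology C] {c : ComplexShape ι} {K L : HomologicalComplex C c}
    (e : K ≅ L) (φ : K ⟶ K) {ψ : L ⟶ L} (h : Homotopy ψ (𝟙 L)) (w : φ ≫ e.hom = e.hom ≫ ψ)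
    (n : ι) : homologyMap φ n = 𝟙 _ := by
  rw [(Iso.eq_comp_inv e).2 w, homologyMap_comp, homologyMap_comp, h.homologyMap_eq,
    homologyMap_id, Category.comp_id, ← homologyMap_comp, e.hom_inv_id, homologyMap_id]

namespace Rep

variable {k G : Type u} [CommRing k] [CommGroup G]

/-- The action of an element `g` of a commutative group on a complex of representations, as a
chain map. -/
noncomputable def applyAsChainMap (P : ChainComplex (Rep.{u} k G) ℕ) (g : G) : P ⟶ P where
  f i := (P.X i).applyAsHom g
  comm' _ _ _ := applyAsHom_comm _ g

/-- On a projective resolution of a trivial representation, the action of `g` is homotopic to the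
identity: both lift the identity of the resolved representation. -/
noncomputable def applyAsChainMapHomotopy {V : Rep.{u} k G} [V.ρ.IsTrivial]
    (P : ProjectiveResolution V) (g : G) :
    Homotopy (applyAsChainMap P.complex g) (𝟙 P.complex) :=
  ProjectiveResolution.liftHomotopy (𝟙 V) _ _
    (by
      ext1
      simp only [applyAsChainMap, ChainComplex.single₀_obj_zero, HomologicalComplex.comp_f,
        CategoryTheory.Functor.map_id, Category.comp_id]
      have : V.applyAsHom g = 𝟙 V := by ext; simp
      exact (applyAsHom_comm (P.π.f 0) g).trans
        ((congrArg (P.π.f 0 ≫ ·) this).trans (Category.comp_id _)))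
    (by simp)

/-- The action of `g` on the bar resolution is homotopic to the identity. -/
noncomputable def barComplexHomotopy (g : G) :
    Homotopy (applyAsChainMap (barComplex k G) g) (𝟙 (barComplex k G)) :=
  applyAsChainMapHomotopy (barResolution k G) g

end Rep

/-! ### The action of the group on its cohomology and homology -/

namespace groupCohomology

open Rep

variable {k G : Type u} [CommRing k]

/-- A commutative group acts trivially on its cohomology: on `Hom(P, V)`, with `P` the bar
resolution, acting by `g` on the values in `V` is the same as precomposing with the action of `g`
on `P`. -/
theorem functor_map_applyAsHom [CommGroup G] (V : Rep.{u} k G) (g : G) (n : ℕ) :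
    (functor k G n).map (V.applyAsHom g) = 𝟙 _ := by
  let F := ((linearYoneda k (Rep.{u} k G)).obj V).rightOp
  let ψ : (barComplex k G).linearYonedaObj k V ⟶ (barComplex k G).linearYonedaObj k V :=
    (HomologicalComplex.unopFunctor _ _).map
      ((F.mapHomologicalComplex _).map (applyAsChainMap (barComplex k G) g)).op
  have H : Homotopy ψ (𝟙 _) := (F.mapHomotopy (barComplexHomotopy g)).unop.trans
    (.ofEq (by rw [CategoryTheory.Functor.map_id]; rfl))
  refine HomologicalComplex.homologyMap_eq_id_of_homotopy_conj (inhomogeneousCochainsIso V)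
    (cochainsMap (MonoidHom.id G) (V.applyAsHom g)) H ?_ n
  ext i : 1
  refine ModuleCat.hom_ext (LinearMap.ext fun f => ?_)
  change freeLift k G V (fun x : Fin i → G => V.ρ g (f x)) =
    (free k G (Fin i → G)).applyAsHom g ≫ freeLift k G V f
  refine free_ext _ _ _ _ _ fun x => ?_
  change (freeLift k G V fun x : Fin i → G => V.ρ g (f x)).hom _ = (freeLift k G V f).hom
    (Representation.free k G (Fin i → G) g (Finsupp.single x (.single 1 1)))
  simp

instance [Group G] (n : ℕ) : (functor k G n).Additive where
  map_add {X Y f g} := by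
    have h : cochainsMap (MonoidHom.id G) (f + g) =
        cochainsMap (MonoidHom.id G) f + cochainsMap (MonoidHom.id G) g :=
      (cochainsFunctor k G).map_add
    simp only [functor_map, map, h]
    exact HomologicalComplex.homologyMap_add _ _ _

end groupCohomology

namespace groupHomology

open Rep

variable {k G : Type u} [CommRing k]

/-- A commutative group acts trivially on its homology: on `(V ⊗ P)_G`, with `P` the bar
resolution, the action of `g` on `V` agrees with that of `g⁻¹` on `P`. -/
theorem functor_map_applyAsHom [CommGroup G] (V : Rep.{u} k G) (g : G) (n : ℕ) :
    (functor k G n).map (V.applyAsHom g) = 𝟙 _ := by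
  classical
  let F := (coinvariantsTensor k G).obj V
  let ψ : (barComplex k G).coinvariantsTensorObj V ⟶ (barComplex k G).coinvariantsTensorObj V :=
    (F.mapHomologicalComplex _).map (applyAsChainMap (barComplex k G) g⁻¹)
  have H : Homotopy ψ (𝟙 _) := (F.mapHomotopy (barComplexHomotopy g⁻¹)).trans
    (.ofEq (by rw [CategoryTheory.Functor.map_id]))
  refine HomologicalComplex.homologyMap_eq_id_of_homotopy_conj (inhomogeneousChainsIso V)
    (chainsMap (MonoidHom.id G) (V.applyAsHom g)) H ?_ n
  ext i x v
  rw [HomologicalComplex.comp_f, HomologicalComplex.comp_f]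
  change finsuppToCoinvariantsTensorFree V (Fin i → G)
      ((chainsMap (MonoidHom.id G) (V.applyAsHom g)).f i (Finsupp.single x v)) =
    (coinvariantsFunctor k G).map
      (MonoidalCategoryStruct.whiskerLeft V ((free k G (Fin i → G)).applyAsHom g⁻¹))
      (finsuppToCoinvariantsTensorFree V (Fin i → G) (Finsupp.single x v))
  rw [chainsMap_f_single]
  erw [finsuppToCoinvariantsTensorFree_single, finsuppToCoinvariantsTensorFree_single]
  exact (Representation.Coinvariants.mk_tmul_inv V.ρ
    (Representation.free k G (Fin i → G)) v _ g).symm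

instance [Group G] (n : ℕ) : (functor k G n).Additive where
  map_add {X Y f g} := by
    have h : chainsMap (MonoidHom.id G) (f + g) =
        chainsMap (MonoidHom.id G) f + chainsMap (MonoidHom.id G) g := by
      ext; simp [add_hom]
    simp only [functor_map, map, h]
    exact HomologicalComplex.homologyMap_add _ _ _

end groupHomology

/-! ### Transfer maps for coinvariants and invariants -/

theorem Representation.norm_ofQuotient_apply {k G V : Type*} [CommRing k] [Group G]
    [AddCommGroup V] [Module k V] (ρ : Representation k G V) (S : Subgroup G) [S.Normal]
    [IsTrivial (ρ.comp S.subtype)] [Fintype (G ⧸ S)] (v : V) :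
    (ρ.ofQuotient S).norm v = ∑ q : G ⧸ S, ρ q.out v := by
  rw [norm, LinearMap.sum_apply]
  refine Finset.sum_congr rfl fun q _ => ?_
  conv_lhs => rw [← QuotientGroup.out_eq' q]
  rfl

namespace CoinvInv

open Representation

variable {k G : Type u} [CommRing k] [CommGroup G] (M : Rep.{u} k G) (S : Subgroup G)
  [Fintype (G ⧸ S)]

/-- The transfer `M_G ⟶ M_S`, sending the class of `m` to the sum over `q : G ⧸ S` of the classes
of `q m`. It is induced by the norm of the action of `G ⧸ S` on `M_S`. -/
noncomputable def coinvariantsTransfer : trivialCoinvariants M ⟶ M.toCoinvariants S :=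
  Rep.ofHom
    ⟨Coinvariants.lift M.ρ
        ((M.ρ.quotientToCoinvariants S).norm ∘ₗ Coinvariants.mk (M.ρ.comp S.subtype))
        fun g => LinearMap.ext fun m =>
          (M.ρ.quotientToCoinvariants S).norm_self_apply (g : G ⧸ S) (Coinvariants.mk _ m),
      fun g => LinearMap.ext fun x => Coinvariants.induction_on x fun m =>
        ((M.ρ.quotientToCoinvariants S).self_norm_apply (g : G ⧸ S) (Coinvariants.mk _ m)).symm⟩

theorem coinvariantsToCoinvariants_comp_coinvariantsTransfer :
    coinvariantsToCoinvariants M S ≫ coinvariantsTransfer M S =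
      ∑ q : G ⧸ S, (M.toCoinvariants S).applyAsHom q.out := by
  refine Rep.hom_ext (IntertwiningMap.ext (LinearMap.ext fun x => ?_))
  refine Coinvariants.induction_on x fun m => ?_
  rw [Rep.sum_hom, IntertwiningMap.toLinearMap_sum, LinearMap.sum_apply]
  exact norm_ofQuotient_apply (M.ρ.toCoinvariants S) S (Coinvariants.mk _ m)

theorem coinvariantsTransfer_comp_coinvariantsToCoinvariants :
    coinvariantsTransfer M S ≫ coinvariantsToCoinvariants M S = Nat.card (G ⧸ S) • 𝟙 _ := by
  refine Rep.hom_ext (IntertwiningMap.ext (LinearMap.ext fun x => ?_))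
  refine Coinvariants.induction_on x fun m => ?_
  change (coinvariantsToCoinvariants M S).hom
      ((M.ρ.quotientToCoinvariants S).norm (Coinvariants.mk _ m)) =
    Nat.card (G ⧸ S) • Coinvariants.mk M.ρ m
  rw [norm_ofQuotient_apply, map_sum, Nat.card_eq_fintype_card]
  exact (Finset.sum_congr rfl fun q _ => Coinvariants.mk_self_apply M.ρ q.out m).trans (by simp)

/-- The transfer `M^S ⟶ M^G`, sending `m` to the sum of `q m` over `q : G ⧸ S`. It is the norm of
the action of `G ⧸ S` on `M^S`. -/
noncomputable def invariantsTransfer : M.toInvariants S ⟶ trivialInvariants M :=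
  Rep.ofHom
    ⟨LinearMap.codRestrict M.ρ.invariants
        (Submodule.subtype _ ∘ₗ (M.ρ.quotientToInvariants S).norm)
        fun m g =>
          congrArg Subtype.val ((M.ρ.quotientToInvariants S).self_norm_apply (g : G ⧸ S) m),
      fun g => LinearMap.ext fun m => Subtype.ext
        (congrArg Subtype.val ((M.ρ.quotientToInvariants S).norm_self_apply (g : G ⧸ S) m) :)⟩

theorem invariantsTransfer_comp_invariantsToInvariants :
    invariantsTransfer M S ≫ invariantsToInvariants M S =
      ∑ q : G ⧸ S, (M.toInvariants S).applyAsHom q.out := by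
  refine Rep.hom_ext (IntertwiningMap.ext (LinearMap.ext fun m => ?_))
  rw [Rep.sum_hom, IntertwiningMap.toLinearMap_sum, LinearMap.sum_apply]
  exact norm_ofQuotient_apply (M.ρ.toInvariants S) S m

theorem invariantsToInvariants_comp_invariantsTransfer :
    invariantsToInvariants M S ≫ invariantsTransfer M S = Nat.card (G ⧸ S) • 𝟙 _ := by
  refine Rep.hom_ext (IntertwiningMap.ext (LinearMap.ext fun m => Subtype.ext ?_))
  change ((M.ρ.quotientToInvariants S).norm ((invariantsToInvariants M S).hom m)).1 =
    ((Nat.card (G ⧸ S) • m : M.ρ.invariants) : M)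
  rw [norm_ofQuotient_apply, Nat.card_eq_fintype_card, Submodule.coe_sum]
  exact (Finset.sum_congr rfl fun q _ => m.2 q.out).trans (by simp)

end CoinvInv

/-! ### Invertibility of the index -/

theorem ModuleCat.isIso_of_comp_eq_nsmul {R : Type u} [CommRing R] {X Y : ModuleCat.{u} R}
    (f : X ⟶ Y) (g : Y ⟶ X) (N : ℕ) (hN : IsUnit (N : R)) (h₁ : f ≫ g = N • 𝟙 X)
    (h₂ : g ≫ f = N • 𝟙 Y) : IsIso f := by
  obtain ⟨u, hu⟩ := hN
  refine ⟨(↑u⁻¹ : R) • g, ?_, ?_⟩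
  · rw [Linear.comp_smul, h₁, ← Nat.cast_smul_eq_nsmul R, ← hu, smul_smul, Units.inv_mul, one_smul]
  · rw [Linear.smul_comp, h₂, ← Nat.cast_smul_eq_nsmul R, ← hu, smul_smul, Units.inv_mul, one_smul]

theorem isUnit_natCast_card_of_pow_eq_one {Q R : Type*} [CommGroup Q] [Finite Q] [CommRing R]
    {l : ℕ} (hl : IsUnit (l : R)) (h : ∀ x : Q, x ^ l = 1) : IsUnit (Nat.card Q : R) :=
  isUnit_of_dvd_unit
    (by simpa using Nat.cast_dvd_cast (α := R) (card_dvd_exponent_pow_rank' Q h)) (hl.pow _)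

theorem theorem1p5 {A : Type u} [CommGroup A] (B : Subgroup A) (l : ℕ)
    (R : Type u) [CommRing R] [IsLocalization.Away (l : ℤ) R]
    (hfin : Finite (A ⧸ B)) (htors : ∀ x : A ⧸ B, x ^ l = 1)
    (M : Rep.{u} R A) (n : ℕ) :
    IsIso ((groupHomology.functor R A n).map (CoinvInv.coinvariantsToCoinvariants M B)) ∧
    IsIso ((groupCohomology.functor R A n).map (CoinvInv.invariantsToInvariants M B)) := by
  have := Fintype.ofFinite (A ⧸ B)
  have hl : IsUnit (l : R) := by
    simpa using IsLocalization.Away.algebraMap_isUnit (S := R) (l : ℤ)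
  have hN := isUnit_natCast_card_of_pow_eq_one hl htors
  constructor
  · refine ModuleCat.isIso_of_comp_eq_nsmul _
      ((groupHomology.functor R A n).map (CoinvInv.coinvariantsTransfer M B)) _ hN ?_ ?_
    · rw [← Functor.map_comp, CoinvInv.coinvariantsToCoinvariants_comp_coinvariantsTransfer,
        Functor.map_sum]
      simp only [groupHomology.functor_map_applyAsHom, Finset.sum_const, Finset.card_univ,
        Nat.card_eq_fintype_card]
    · rw [← Functor.map_comp, CoinvInv.coinvariantsTransfer_comp_coinvariantsToCoinvariants,
        Functor.map_nsmul, CategoryTheory.Functor.map_id]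
  · refine ModuleCat.isIso_of_comp_eq_nsmul _
      ((groupCohomology.functor R A n).map (CoinvInv.invariantsTransfer M B)) _ hN ?_ ?_
    · rw [← Functor.map_comp, CoinvInv.invariantsToInvariants_comp_invariantsTransfer,
        Functor.map_nsmul, CategoryTheory.Functor.map_id]
    · rw [← Functor.map_comp, CoinvInv.invariantsTransfer_comp_invariantsToInvariants,
        Functor.map_sum]
      simp only [groupCohomology.functor_map_applyAsHom, Finset.sum_const, Finset.card_univ,
        Nat.card_eq_fintype_card]
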